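/- Let $\lambda>0$, $\mu>0$, $T>0$, and let $\gamma$ be the centred Gaussian law on $\mathbb{R}$ with variance $T$. Let $\mathcal{M}$ be the set of finite non-negative Borel measures on $\mathbb{R}$, metrized by the total variation norm $\|\cdot\|$. For $\nu_1,\nu_2\in\mathcal{M}$ let $B[\nu_1,\nu_2]\in\mathcal{M}$ be the measure such that, for all bounded continuous $\phi$, \[ \int_{\mathbb{R}} \phi(x)\, B[\nu_1,\nu_2](dx) = \int_{\mathbb{R}}\int_{\mathbb{R}} \nu_1(dx)\,\nu_2(dy) \int_0^{2\pi} \phi(x\cos\theta + y\sin\theta)\,\frac{d\theta}{2\pi}. \] A weak solution of the thermostated Boltzmann–Kac equation with initial condition $f_0$ is a function $f\in C([0,\infty),\mathcal{M})$ such that for all $t\ge 0$ \[ f_t = f_0 + \int_0^t \left\{ 2\lambda\,(B[f_s,f_s]-f_s) + \mu\,(B[f_s,\gamma]-f_s)\right\} ds . \] For probability measures $f,g$ on $\mathbb{R}$ let $W_2(f,g) = \left(\inf \mathbb{E}[(X-Y)^2]\right)^{1/2}\in[0,\infty]$, the infimum being over all pairs of random variables $(X,Y)$ with $\mathrm{Law}(X)=f$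 and $\mathrm{Law}(Y)=g$. Let $(f_t)_{t\ge0}$ and $(\tilde f_t)_{t\ge0}$ be weak solutions with initial conditions $f_0$ and $\tilde f_0$, where $f_0,\tilde f_0$ are arbitrary probability measures on $\mathbb{R}$. Then for all $t\ge 0$ \[ W_2^2(f_t,\tilde f_t) \le e^{-\frac{\mu}{2}t}\, W_2^2(f_0,\tilde f_0). \] Consequently (taking $\tilde f_0=\gamma$), for every weak solution $(f_t)_{t\ge0}$ starting from a probability measure $f_0$ and all $t\ge0$, \[ W_2^2(f_t,\gamma) \le e^{-\frac{\mu}{2}t}\, W_2^2(f_0,\gamma). \] (If the right-hand side is infinite, the inequality holds trivially.) -/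

import Mathlib

open MeasureTheory ProbabilityTheory Filter Topology
open scoped NNReal ENNReal

namespace ThermostatedKac

noncomputable section

/-- The uniform probability measure `dθ / 2π` on `[0, 2π)`. -/
def unifAngle : Measure ℝ :=
  (ENNReal.ofReal (2 * Real.pi))⁻¹ • volume.restrict (Set.Ico 0 (2 * Real.pi))

instance instIsProbabilityMeasureUnifAngle : IsProbabilityMeasure unifAngle := by
  constructor
  have h : 0 < 2 * Real.pi := by positivity
  simp only [unifAngle, Measure.smul_apply, Measure.restrict_apply_univ, Real.volume_Ico,
    smul_eq_mul, sub_zero]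
  exact ENNReal.inv_mul_cancel (by simpa using h) ENNReal.ofReal_ne_top

/-- The collision measure `B[ν₁, ν₂]` as a Borel measure: the image of `ν₁ ⊗ ν₂ ⊗ dθ/2π` under
`(x, y, θ) ↦ x cos θ + y sin θ`, that is,
`∫ φ dB[ν₁, ν₂] = ∫∫ ν₁(dx) ν₂(dy) ∫ φ(x cos θ + y sin θ) dθ/2π`. -/
def collisionMeasure (ν₁ ν₂ : Measure ℝ) : Measure ℝ :=
  (ν₁.prod (ν₂.prod unifAngle)).map
    (fun p : ℝ × ℝ × ℝ => p.1 * Real.cos p.2.2 + p.2.1 * Real.sin p.2.2)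

instance instIsFiniteMeasureCollisionMeasure (ν₁ ν₂ : Measure ℝ) [IsFiniteMeasure ν₁]
    [IsFiniteMeasure ν₂] : IsFiniteMeasure (collisionMeasure ν₁ ν₂) := by
  unfold collisionMeasure
  infer_instance

/-- The bilinear map `B : 𝓜 × 𝓜 → 𝓜` on finite nonnegative Borel measures on `ℝ`. -/
def B (ν₁ ν₂ : FiniteMeasure ℝ) : FiniteMeasure ℝ :=
  ⟨collisionMeasure (ν₁ : Measure ℝ) (ν₂ : Measure ℝ), inferInstance⟩

/-- The centred Gaussian law `γ` on `ℝ` with variance (temperature) `T`. -/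
def gauss (T : ℝ≥0) : ProbabilityMeasure ℝ :=
  ⟨gaussianReal 0 T, inferInstance⟩

/-- The total variation distance `‖ν₁ - ν₂‖ = |ν₁ - ν₂|(ℝ)` between finite measures. -/
def tvDist (ν₁ ν₂ : FiniteMeasure ℝ) : ℝ≥0∞ :=
  ((ν₁ : Measure ℝ).toSignedMeasure - (ν₂ : Measure ℝ).toSignedMeasure).totalVariation Set.univ

/-- `f ∈ C([0, ∞), 𝓜)` is a weak solution of the thermostated Boltzmann–Kac equation with
initial condition `f₀`. Only the values `f t` for `t ≥ 0` matter. The equality of measures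
`f_t = f₀ + ∫₀ᵗ {2λ (B[f_s, f_s] - f_s) + μ (B[f_s, γ] - f_s)} ds` is read on every Borel set;
the integrand is continuous in `s` by continuity of `f` in total variation. -/
structure IsWeakSolution (lam mu : ℝ) (T : ℝ≥0) (f₀ : FiniteMeasure ℝ)
    (f : ℝ → FiniteMeasure ℝ) : Prop where
  continuous_tv : ∀ t : ℝ, 0 ≤ t →
    Tendsto (fun s => tvDist (f s) (f t)) (𝓝[Set.Ici 0] t) (𝓝 0)
  equation : ∀ t : ℝ, 0 ≤ t → ∀ A : Set ℝ, MeasurableSet A →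
    (f t : Measure ℝ).real A = (f₀ : Measure ℝ).real A +
      ∫ s in (0 : ℝ)..t,
        (2 * lam * ((B (f s) (f s) : Measure ℝ).real A - (f s : Measure ℝ).real A) +
          mu * ((B (f s) (gauss T).toFiniteMeasure : Measure ℝ).real A
            - (f s : Measure ℝ).real A))

/-- The `2`-Wasserstein distance between probability measures on `ℝ`, with values in `[0, ∞]`:
the infimum of `E[(X - Y)²]^(1/2)` over all couplings `(X, Y)`, represented by their joint law. -/
def W2 (ν₁ ν₂ : Measure ℝ) : ℝ≥0∞ :=
  (⨅ (π : Measure (ℝ × ℝ)) (_ : π.map Prod.fst = ν₁ ∧ π.map Prod.snd = ν₂),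
    ∫⁻ p, ENNReal.ofReal ((p.1 - p.2) ^ 2) ∂π) ^ (1 / 2 : ℝ)

end

end ThermostatedKac

/-!
The contraction comes from coupling two solutions by letting the paired particles collide with
common angles and with common thermostat particles. For a measure `π` on `ℝ × ℝ` write
`cost π = ∫ (x - y)² dπ`. Averaging over the angle removes the cross term in
`((x - x') cos θ + (y - y') sin θ)²`, so a binary collision of pairs preserves the cost
(`cost_pairCollision`), whereas a collision with a pair `(y, y)`, `y ~ γ`, halves it. Hence along
the coupled equation `∂ₜπ = 2λ (B[π, π] - π) + μ (B[π, Γ] - π)` with `Γ` the diagonal coupling of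
`γ`, the cost decays at rate `μ / 2`.

To make this rigorous for arbitrary weak solutions, existence for the coupled equation and
uniqueness for the original one are obtained together from monotone Picard iterates `picard` of the
mild formulation, started from zero. They increase, their cost is at most `e^{-μt/2} cost π₀`
(`cost_picard_le`), their marginals stay below any weak solution (`map_picard_le`, using that a weak
solution satisfies Duhamel's formula `IsWeakSolution.mild`), and their mass tends to one
(`one_le_picard_univ_add`). Weak solutions have mass one (`IsWeakSolution.measure_univ`), so the
marginals of the limit coincide with the given solutions (`exists_coupling`). Minimizing over the
initial coupling gives the estimate between two solutions, and the convergence to `γ` is the case of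
the stationary solution `γ`, whose invariance is `collisionMeasure_gaussianReal`.
-/

namespace ThermostatedKac

noncomputable section

/-! ### Collisions of pairs -/

/-- The collision rule on `ℝ × ℝ`: both components are rotated by the same angle. -/
def collisionMap (p : (ℝ × ℝ) × (ℝ × ℝ) × ℝ) : ℝ × ℝ :=
  (p.1.1 * Real.cos p.2.2 + p.2.1.1 * Real.sin p.2.2,
    p.1.2 * Real.cos p.2.2 + p.2.1.2 * Real.sin p.2.2)

lemma measurable_collisionMap : Measurable collisionMap := by
  unfold collisionMap
  fun_prop

/-- The analogue of `collisionMeasure` for measures on `ℝ × ℝ`, the two colliding pairs being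
rotated by a common random angle. -/
def pairCollision (π₁ π₂ : Measure (ℝ × ℝ)) : Measure (ℝ × ℝ) :=
  (π₁.prod (π₂.prod unifAngle)).map collisionMap

lemma pairCollision_univ (π₁ π₂ : Measure (ℝ × ℝ)) [SFinite π₂] :
    pairCollision π₁ π₂ Set.univ = π₁ Set.univ * π₂ Set.univ := by
  have h : (π₂.prod unifAngle) Set.univ = π₂ Set.univ := by
    rw [← Set.univ_prod_univ, Measure.prod_prod, measure_univ (μ := unifAngle), mul_one]
  rw [pairCollision, Measure.map_apply measurable_collisionMap .univ, Set.preimage_univ,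
    ← Set.univ_prod_univ, Measure.prod_prod, h]

lemma collisionMeasure_univ (ν₁ ν₂ : Measure ℝ) [SFinite ν₂] :
    collisionMeasure ν₁ ν₂ Set.univ = ν₁ Set.univ * ν₂ Set.univ := by
  rw [collisionMeasure, Measure.map_apply (by fun_prop) .univ, Set.preimage_univ,
    ← Set.univ_prod_univ, Measure.prod_prod, ← Set.univ_prod_univ, Measure.prod_prod]
  simp

lemma pairCollision_mono {π₁ π₂ π₁' π₂' : Measure (ℝ × ℝ)} [SFinite π₂] [SFinite π₂']
    (h₁ : π₁ ≤ π₁') (h₂ : π₂ ≤ π₂') : pairCollision π₁ π₂ ≤ pairCollision π₁' π₂' :=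
  Measure.map_mono (Measure.prod_mono h₁ (Measure.prod_mono h₂ le_rfl)) measurable_collisionMap

lemma collisionMeasure_mono {ν₁ ν₂ ν₁' ν₂' : Measure ℝ} [SFinite ν₂] [SFinite ν₂']
    (h₁ : ν₁ ≤ ν₁') (h₂ : ν₂ ≤ ν₂') : collisionMeasure ν₁ ν₂ ≤ collisionMeasure ν₁' ν₂' :=
  Measure.map_mono (Measure.prod_mono h₁ (Measure.prod_mono h₂ le_rfl)) (by fun_prop)

/-- Collisions commute with linear maps. -/
lemma map_pairCollision (L : ℝ × ℝ →L[ℝ] ℝ) (π₁ π₂ : Measure (ℝ × ℝ)) [SFinite π₁] [SFinite π₂] :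
    (pairCollision π₁ π₂).map L = collisionMeasure (π₁.map L) (π₂.map L) := by
  have hL : Measurable L := L.continuous.measurable
  have h2 : (π₂.map L).prod unifAngle = (π₂.prod unifAngle).map (Prod.map L id) := by
    conv_lhs => rw [← Measure.map_id (μ := unifAngle)]
    exact Measure.map_prod_map _ _ hL measurable_id
  rw [pairCollision, collisionMeasure, h2, Measure.map_prod_map _ _ hL (hL.prodMap measurable_id),
    Measure.map_map hL measurable_collisionMap,
    Measure.map_map (by fun_prop) (hL.prodMap (hL.prodMap measurable_id))]
  congr 1
  ext p
  have : collisionMap p = Real.cos p.2.2 • p.1 + Real.sin p.2.2 • p.2.1 := by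
    ext <;> simp [collisionMap, mul_comm]
  simp [this, mul_comm]

/-! ### The transport cost -/

/-- The quadratic transport cost of a coupling. -/
def cost (π : Measure (ℝ × ℝ)) : ℝ≥0∞ :=
  ∫⁻ p, ENNReal.ofReal ((p.1 - p.2) ^ 2) ∂π

lemma measurable_sq_sub : Measurable fun p : ℝ × ℝ => ENNReal.ofReal ((p.1 - p.2) ^ 2) := by
  fun_prop

lemma lintegral_unifAngle_sq (u v : ℝ) :
    ∫⁻ θ, ENNReal.ofReal ((u * Real.cos θ + v * Real.sin θ) ^ 2) ∂unifAngle =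
      (ENNReal.ofReal (u ^ 2) + ENNReal.ofReal (v ^ 2)) / 2 := by
  have hpi : 0 < 2 * Real.pi := by positivity
  have hc : Continuous fun θ : ℝ => (u * Real.cos θ + v * Real.sin θ) ^ 2 := by fun_prop
  have key : ∫ θ in (0 : ℝ)..(2 * Real.pi), (u * Real.cos θ + v * Real.sin θ) ^ 2 =
      2 * Real.pi * ((u ^ 2 + v ^ 2) / 2) := by
    have : ∀ θ : ℝ, (u * Real.cos θ + v * Real.sin θ) ^ 2 =
        u ^ 2 * Real.cos θ ^ 2 + 2 * u * v * (Real.sin θ * Real.cos θ) +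
          v ^ 2 * Real.sin θ ^ 2 := fun θ => by ring
    simp_rw [this]
    rw [intervalIntegral.integral_add (Continuous.intervalIntegrable (by fun_prop) _ _)
      (Continuous.intervalIntegrable (by fun_prop) _ _),
      intervalIntegral.integral_add (Continuous.intervalIntegrable (by fun_prop) _ _)
      (Continuous.intervalIntegrable (by fun_prop) _ _)]
    simp only [intervalIntegral.integral_const_mul, integral_cos_sq, integral_sin_sq,
      integral_sin_mul_cos₁]
    simp
    ring
  rw [unifAngle, lintegral_smul_measure, setLIntegral_congr Ico_ae_eq_Ioc,
    ← ofReal_integral_eq_lintegral_ofReal, ← intervalIntegral.integral_of_le hpi.le, key,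
    smul_eq_mul, ENNReal.ofReal_mul hpi.le, ← mul_assoc,
    ENNReal.inv_mul_cancel (by simpa using hpi) ENNReal.ofReal_ne_top, one_mul,
    ENNReal.ofReal_div_of_pos two_pos, ENNReal.ofReal_add (sq_nonneg _) (sq_nonneg _)]
  · simp
  · exact (hc.integrableOn_Icc (a := 0) (b := 2 * Real.pi)).mono_set Set.Ioc_subset_Icc_self
  · exact Eventually.of_forall fun θ => sq_nonneg _

/-- Averaging over the angle kills the cross term, so a collision averages the costs. -/
lemma cost_pairCollision (π₁ π₂ : Measure (ℝ × ℝ)) [SFinite π₁] [SFinite π₂] :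
    cost (pairCollision π₁ π₂) =
      (cost π₁ * π₂ Set.univ + π₁ Set.univ * cost π₂) / 2 := by
  have h : ∀ q r : ℝ × ℝ,
      ∫⁻ θ, ENNReal.ofReal (((collisionMap (q, r, θ)).1 - (collisionMap (q, r, θ)).2) ^ 2)
        ∂unifAngle =
      (ENNReal.ofReal ((q.1 - q.2) ^ 2) + ENNReal.ofReal ((r.1 - r.2) ^ 2)) / 2 := by
    intro q r
    rw [← lintegral_unifAngle_sq]
    refine lintegral_congr fun θ => ?_
    simp only [collisionMap]
    congr 1
    ring
  have hm : Measurable fun x =>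
      ENNReal.ofReal (((collisionMap x).1 - (collisionMap x).2) ^ 2) :=
    measurable_sq_sub.comp measurable_collisionMap
  have hr := measurable_sq_sub
  have inner : ∀ q : ℝ × ℝ, ∫⁻ x, ENNReal.ofReal
      (((collisionMap (q, x)).1 - (collisionMap (q, x)).2) ^ 2) ∂π₂.prod unifAngle =
      (ENNReal.ofReal ((q.1 - q.2) ^ 2) * π₂ Set.univ + cost π₂) * 2⁻¹ := by
    intro q
    have hq : Measurable fun x : (ℝ × ℝ) × ℝ =>
        ENNReal.ofReal (((collisionMap (q, x)).1 - (collisionMap (q, x)).2) ^ 2) :=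
      hm.comp measurable_prodMk_left
    rw [lintegral_prod _ hq.aemeasurable]
    simp_rw [h, div_eq_mul_inv]
    rw [lintegral_mul_const _ (by fun_prop), lintegral_add_left measurable_const,
      lintegral_const, cost]
  rw [cost, pairCollision, lintegral_map measurable_sq_sub measurable_collisionMap,
    lintegral_prod _ hm.aemeasurable]
  simp_rw [inner]
  rw [lintegral_mul_const _ (by fun_prop), lintegral_add_right _ measurable_const,
    lintegral_mul_const _ hr, lintegral_const, mul_comm (cost π₂), div_eq_mul_inv, cost, cost]

/-! ### Invariance of the Gaussian law -/

lemma collisionMeasure_gaussianReal (T : ℝ≥0) :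
    collisionMeasure (gaussianReal 0 T) (gaussianReal 0 T) = gaussianReal 0 T := by
  have rot : ∀ θ : ℝ, ((gaussianReal 0 T).prod (gaussianReal 0 T)).map
      (fun p : ℝ × ℝ => p.1 * Real.cos θ + p.2 * Real.sin θ) = gaussianReal 0 T := by
    intro θ
    have h : (fun p : ℝ × ℝ => p.1 * Real.cos θ + p.2 * Real.sin θ) =
        (fun p : ℝ × ℝ => p.1 + p.2) ∘ Prod.map (· * Real.cos θ) (· * Real.sin θ) := rfl
    rw [h, ← Measure.map_map (by fun_prop) (by fun_prop),
      ← Measure.map_prod_map _ _ (by fun_prop) (by fun_prop), gaussianReal_map_mul_const,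
      gaussianReal_map_mul_const]
    change (gaussianReal _ _).conv (gaussianReal _ _) = _
    rw [gaussianReal_conv_gaussianReal]
    congr 1
    · simp
    · ext
      simp only [NNReal.coe_add, NNReal.coe_mul, NNReal.coe_mk]
      rw [← add_mul, Real.cos_sq_add_sin_sq, one_mul]
  ext A hA
  have hm : Measurable fun p : ℝ × ℝ × ℝ => p.1 * Real.cos p.2.2 + p.2.1 * Real.sin p.2.2 := by
    fun_prop
  rw [collisionMeasure, ← Measure.prodAssoc_prod, Measure.map_map hm (by fun_prop),
    Measure.map_apply (hm.comp (by fun_prop)) hA,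
    Measure.prod_apply_symm ((hm.comp (by fun_prop)) hA)]
  have : ∀ θ : ℝ, ((gaussianReal 0 T).prod (gaussianReal 0 T))
      ((fun x : ℝ × ℝ => (x, θ)) ⁻¹' (((fun p : ℝ × ℝ × ℝ => p.1 * Real.cos p.2.2 + p.2.1 *
        Real.sin p.2.2) ∘ MeasurableEquiv.prodAssoc) ⁻¹' A)) = gaussianReal 0 T A := by
    intro θ
    conv_rhs => rw [← rot θ, Measure.map_apply (by fun_prop) hA]
    rfl
  simp [this]

/-! ### Total variation continuity -/

/-- A finite measure exceeds another one by at most the variation measure of the difference. -/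
lemma le_add_totalVariation (ν₁ ν₂ : FiniteMeasure ℝ) :
    (ν₁ : Measure ℝ) ≤ ν₂ + ((ν₁ : Measure ℝ).toSignedMeasure -
      (ν₂ : Measure ℝ).toSignedMeasure).totalVariation := by
  set s := (ν₁ : Measure ℝ).toSignedMeasure - (ν₂ : Measure ℝ).toSignedMeasure with hs
  refine Measure.le_iff.2 fun A hA => ?_
  have h1 : s A = (ν₁ : Measure ℝ).real A - (ν₂ : Measure ℝ).real A := by
    rw [hs, Measure.toSignedMeasure_sub_apply hA]
  have h2 := s.apply_eq_posPart_real_sub_negPart_real hA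
  have h3 : (ν₁ : Measure ℝ).real A ≤
      (ν₂ : Measure ℝ).real A + s.toJordanDecomposition.posPart.real A := by
    have : 0 ≤ s.toJordanDecomposition.negPart.real A := measureReal_nonneg
    linarith
  have h4 : (ν₁ : Measure ℝ) A ≤ (ν₂ : Measure ℝ) A + s.toJordanDecomposition.posPart A := by
    rw [← ofReal_measureReal (μ := (ν₁ : Measure ℝ)), ← ofReal_measureReal (μ := (ν₂ : Measure ℝ)),
      ← ofReal_measureReal (μ := s.toJordanDecomposition.posPart),
      ← ENNReal.ofReal_add measureReal_nonneg measureReal_nonneg]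
    exact ENNReal.ofReal_le_ofReal h3
  refine h4.trans ?_
  rw [Measure.add_apply, SignedMeasure.totalVariation, Measure.add_apply]
  gcongr
  exact le_self_add

lemma tvDist_comm (ν₁ ν₂ : FiniteMeasure ℝ) : tvDist ν₁ ν₂ = tvDist ν₂ ν₁ := by
  rw [tvDist, tvDist, ← SignedMeasure.totalVariation_neg, neg_sub]

lemma tvDist_self (ν : FiniteMeasure ℝ) : tvDist ν ν = 0 := by
  simp [tvDist, SignedMeasure.totalVariation_zero]

lemma tvDist_ne_top (ν₁ ν₂ : FiniteMeasure ℝ) : tvDist ν₁ ν₂ ≠ ∞ := by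
  rw [tvDist, SignedMeasure.totalVariation]
  exact measure_ne_top _ _

lemma collisionMeasure_add_left (ν₁ ν₁' ν₂ : Measure ℝ) [SFinite ν₁] [SFinite ν₁']
    [SFinite ν₂] :
    collisionMeasure (ν₁ + ν₁') ν₂ = collisionMeasure ν₁ ν₂ + collisionMeasure ν₁' ν₂ := by
  rw [collisionMeasure, Measure.add_prod, Measure.map_add _ _ (by fun_prop)]
  rfl

lemma collisionMeasure_add_right (ν₁ ν₂ ν₂' : Measure ℝ) [SFinite ν₁] [SFinite ν₂]
    [SFinite ν₂'] :
    collisionMeasure ν₁ (ν₂ + ν₂') = collisionMeasure ν₁ ν₂ + collisionMeasure ν₁ ν₂' := by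
  rw [collisionMeasure, Measure.add_prod, Measure.prod_add, Measure.map_add _ _ (by fun_prop)]
  rfl

/-- The collision measure is locally Lipschitz for the total variation norm. -/
lemma collisionMeasure_real_le (ν₁ ν₂ η₁ η₂ : FiniteMeasure ℝ) (A : Set ℝ) :
    (B ν₁ ν₂ : Measure ℝ).real A ≤ (B η₁ η₂ : Measure ℝ).real A +
      ((η₁ : Measure ℝ).real Set.univ * (tvDist ν₂ η₂).toReal +
        (tvDist ν₁ η₁).toReal * ((η₂ : Measure ℝ).real Set.univ + (tvDist ν₂ η₂).toReal)) := by
  set σ₁ := ((ν₁ : Measure ℝ).toSignedMeasure - (η₁ : Measure ℝ).toSignedMeasure).totalVariation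
    with hσ₁
  set σ₂ := ((ν₂ : Measure ℝ).toSignedMeasure - (η₂ : Measure ℝ).toSignedMeasure).totalVariation
    with hσ₂
  have : IsFiniteMeasure σ₁ := by rw [hσ₁, SignedMeasure.totalVariation]; infer_instance
  have : IsFiniteMeasure σ₂ := by rw [hσ₂, SignedMeasure.totalVariation]; infer_instance
  have h1 : collisionMeasure ν₁ ν₂ ≤ collisionMeasure η₁ η₂ +
      (collisionMeasure η₁ σ₂ + collisionMeasure σ₁ (η₂ + σ₂)) := by
    refine (collisionMeasure_mono (le_add_totalVariation ν₁ η₁)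
      (le_add_totalVariation ν₂ η₂)).trans (le_of_eq ?_)
    rw [← hσ₁, ← hσ₂, collisionMeasure_add_left, collisionMeasure_add_right η₁, add_assoc]
  have h2 : (collisionMeasure ν₁ ν₂) A ≤ (collisionMeasure η₁ η₂) A +
      ((η₁ : Measure ℝ) Set.univ * σ₂ Set.univ +
        σ₁ Set.univ * ((η₂ : Measure ℝ) Set.univ + σ₂ Set.univ)) := by
    refine (h1 A).trans ?_
    simp only [Measure.add_apply]
    gcongr
    · exact (measure_mono (Set.subset_univ A)).trans_eq (collisionMeasure_univ _ _)
    · refine (measure_mono (Set.subset_univ A)).trans_eq ?_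
      rw [collisionMeasure_univ, Measure.add_apply]
  have h3 := ENNReal.toReal_mono (by finiteness) h2
  rw [ENNReal.toReal_add (by finiteness) (by finiteness),
    ENNReal.toReal_add (by finiteness) (by finiteness), ENNReal.toReal_mul, ENNReal.toReal_mul,
    ENNReal.toReal_add (by finiteness) (by finiteness)] at h3
  exact h3

lemma measureReal_le_add_tvDist (ν η : FiniteMeasure ℝ) (A : Set ℝ) :
    (ν : Measure ℝ).real A ≤ (η : Measure ℝ).real A + (tvDist ν η).toReal := by
  have h := (le_add_totalVariation ν η A).trans
    (add_le_add_right (measure_mono (Set.subset_univ A)) _)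
  have h3 := ENNReal.toReal_mono (ENNReal.add_ne_top.2 ⟨measure_ne_top _ _, tvDist_ne_top ν η⟩) h
  rwa [ENNReal.toReal_add (measure_ne_top _ _) (tvDist_ne_top ν η)] at h3

/-- Continuity of a curve of finite measures in total variation. -/
def ContinuousTV (F : ℝ → FiniteMeasure ℝ) : Prop :=
  ∀ t, Tendsto (fun s => tvDist (F s) (F t)) (𝓝 t) (𝓝 0)

lemma ContinuousTV.tendsto_toReal {F : ℝ → FiniteMeasure ℝ} (hF : ContinuousTV F) (t : ℝ) :
    Tendsto (fun s => (tvDist (F s) (F t)).toReal) (𝓝 t) (𝓝 0) :=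
  (ENNReal.tendsto_toReal ENNReal.zero_ne_top).comp (hF t)

lemma ContinuousTV.continuous_measureReal {F : ℝ → FiniteMeasure ℝ} (hF : ContinuousTV F)
    (A : Set ℝ) : Continuous fun t => (F t : Measure ℝ).real A := by
  refine continuous_iff_continuousAt.2 fun t => ?_
  refine tendsto_iff_dist_tendsto_zero.2 (squeeze_zero (fun _ => dist_nonneg) (fun s => ?_)
    (hF.tendsto_toReal t))
  have h1 := measureReal_le_add_tvDist (F s) (F t) A
  have h2 := measureReal_le_add_tvDist (F t) (F s) A
  rw [tvDist_comm] at h2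
  rw [Real.dist_eq, abs_le]
  constructor <;> linarith

lemma continuousTV_const (ν : FiniteMeasure ℝ) : ContinuousTV fun _ => ν := fun t => by
  simp [tvDist_self]

lemma ContinuousTV.continuous_B {F G : ℝ → FiniteMeasure ℝ} (hF : ContinuousTV F)
    (hG : ContinuousTV G) (A : Set ℝ) :
    Continuous fun t => (B (F t) (G t) : Measure ℝ).real A := by
  refine continuous_iff_continuousAt.2 fun t => ?_
  have hd := hF.tendsto_toReal t
  have he := hG.tendsto_toReal t
  have hm := ((hF.continuous_measureReal Set.univ).tendsto t)
  have hn := ((hG.continuous_measureReal Set.univ).tendsto t)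
  have hlow : Tendsto (fun s => (B (F t) (G t) : Measure ℝ).real A -
      ((F s : Measure ℝ).real Set.univ * (tvDist (G s) (G t)).toReal +
        (tvDist (F s) (F t)).toReal * ((G s : Measure ℝ).real Set.univ +
          (tvDist (G s) (G t)).toReal))) (𝓝 t) (𝓝 ((B (F t) (G t) : Measure ℝ).real A)) := by
    simpa using tendsto_const_nhds.sub ((hm.mul he).add (hd.mul (hn.add he)))
  have hup : Tendsto (fun s => (B (F t) (G t) : Measure ℝ).real A +
      ((F t : Measure ℝ).real Set.univ * (tvDist (G s) (G t)).toReal +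
        (tvDist (F s) (F t)).toReal * ((G t : Measure ℝ).real Set.univ +
          (tvDist (G s) (G t)).toReal))) (𝓝 t) (𝓝 ((B (F t) (G t) : Measure ℝ).real A)) := by
    simpa using tendsto_const_nhds.add
      ((tendsto_const_nhds.mul he).add (hd.mul (tendsto_const_nhds.add he)))
  refine tendsto_of_tendsto_of_tendsto_of_le_of_le hlow hup (fun s => ?_) (fun s => ?_)
  · have := collisionMeasure_real_le (F t) (G t) (F s) (G s) A
    rw [tvDist_comm (F t), tvDist_comm (G t)] at this
    simp only
    linarith
  · exact collisionMeasure_real_le (F s) (G s) (F t) (G t) A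

/-! ### The mild formulation -/

/-- Extending a weak solution by its initial value to negative times makes it continuous on `ℝ`. -/
lemma IsWeakSolution.continuousTV {lam mu : ℝ} {T : ℝ≥0} {f₀ : FiniteMeasure ℝ}
    {f : ℝ → FiniteMeasure ℝ} (hf : IsWeakSolution lam mu T f₀ f) :
    ContinuousTV fun t => f (max t 0) := fun t => by
  have h : Tendsto (fun s : ℝ => max s 0) (𝓝 t) (𝓝[Set.Ici 0] (max t 0)) :=
    tendsto_nhdsWithin_iff.2 ⟨(continuous_id.max continuous_const).tendsto t,
      Eventually.of_forall fun s => le_max_right s 0⟩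
  exact (hf.continuous_tv _ (le_max_right t 0)).comp h

/-- A weak solution has the value `f₀` at time zero. -/
lemma IsWeakSolution.apply_zero {lam mu : ℝ} {T : ℝ≥0} {f₀ : FiniteMeasure ℝ}
    {f : ℝ → FiniteMeasure ℝ} (hf : IsWeakSolution lam mu T f₀ f) {A : Set ℝ}
    (hA : MeasurableSet A) : (f 0 : Measure ℝ).real A = (f₀ : Measure ℝ).real A := by
  simpa using hf.equation 0 le_rfl A hA

/-- The weak formulation in differential form. -/
lemma IsWeakSolution.hasDerivWithinAt {lam mu : ℝ} {T : ℝ≥0} {f₀ : FiniteMeasure ℝ}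
    {f : ℝ → FiniteMeasure ℝ} (hf : IsWeakSolution lam mu T f₀ f) {A : Set ℝ}
    (hA : MeasurableSet A) {t : ℝ} (ht : 0 ≤ t) :
    HasDerivWithinAt (fun t => (f t : Measure ℝ).real A)
      (2 * lam * ((B (f t) (f t) : Measure ℝ).real A - (f t : Measure ℝ).real A) +
        mu * ((B (f t) (gauss T).toFiniteMeasure : Measure ℝ).real A
          - (f t : Measure ℝ).real A)) (Set.Ici 0) t := by
  have hF := hf.continuousTV
  set R : ℝ → ℝ := fun s => 2 * lam * ((B (f (max s 0)) (f (max s 0)) : Measure ℝ).real A -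
    (f (max s 0) : Measure ℝ).real A) + mu * ((B (f (max s 0)) (gauss T).toFiniteMeasure :
      Measure ℝ).real A - (f (max s 0) : Measure ℝ).real A) with hR
  have hRc : Continuous R := by
    have h1 := hF.continuous_B hF A
    have h2 := hF.continuous_B (continuousTV_const (gauss T).toFiniteMeasure) A
    have h3 := hF.continuous_measureReal A
    fun_prop
  have hd : HasDerivAt (fun t => (f₀ : Measure ℝ).real A + ∫ s in (0 : ℝ)..t, R s) (R t) t :=
    (intervalIntegral.integral_hasDerivAt_right (hRc.intervalIntegrable _ _)
      (hRc.stronglyMeasurableAtFilter _ _) hRc.continuousAt).const_add _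
  have heq : ∀ u ∈ Set.Ici (0 : ℝ), (f u : Measure ℝ).real A =
      (f₀ : Measure ℝ).real A + ∫ s in (0 : ℝ)..u, R s := by
    intro u hu
    rw [hf.equation u hu A hA]
    congr 1
    refine intervalIntegral.integral_congr fun s hs => ?_
    rw [Set.uIcc_of_le hu] at hs
    simp only [hR, max_eq_left hs.1]
  have := (hd.hasDerivWithinAt (s := Set.Ici 0)).congr heq (heq t ht)
  simpa only [hR, max_eq_left ht] using this

lemma IsWeakSolution.continuousOn_measureReal {lam mu : ℝ} {T : ℝ≥0} {f₀ : FiniteMeasure ℝ}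
    {f : ℝ → FiniteMeasure ℝ} (hf : IsWeakSolution lam mu T f₀ f) {A : Set ℝ}
    (hA : MeasurableSet A) : ContinuousOn (fun t => (f t : Measure ℝ).real A) (Set.Ici 0) :=
  fun _ ht => (hf.hasDerivWithinAt hA ht).continuousWithinAt

/-- The mass `m` solves `m' = 2λ m (m - 1)`, so it stays equal to one. -/
lemma IsWeakSolution.measure_univ {lam mu : ℝ} {T : ℝ≥0} {f₀ : ProbabilityMeasure ℝ}
    {f : ℝ → FiniteMeasure ℝ} (hf : IsWeakSolution lam mu T f₀.toFiniteMeasure f) {t : ℝ}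
    (ht : 0 ≤ t) : (f t : Measure ℝ) Set.univ = 1 := by
  set m : ℝ → ℝ := fun s => (f s : Measure ℝ).real Set.univ with hm
  have hder : ∀ s, 0 ≤ s →
      HasDerivWithinAt (fun s => m s - 1) (2 * lam * m s * (m s - 1)) (Set.Ici 0) s := by
    intro s hs
    refine ((hf.hasDerivWithinAt .univ hs).sub_const 1).congr_deriv ?_
    have h1 : (B (f s) (f s) : Measure ℝ).real Set.univ = m s * m s := by
      rw [measureReal_def]
      exact (congrArg ENNReal.toReal (collisionMeasure_univ _ _)).trans ENNReal.toReal_mul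
    have h2 : (B (f s) (gauss T).toFiniteMeasure : Measure ℝ).real Set.univ = m s := by
      rw [measureReal_def]
      refine (congrArg ENNReal.toReal (collisionMeasure_univ _ _)).trans ?_
      rw [ENNReal.toReal_mul]
      simp [hm, measureReal_def]
    rw [h1, h2]
    change 2 * lam * (m s * m s - m s) + mu * (m s - m s) = _
    ring
  have hmc : ContinuousOn (fun s => m s - 1) (Set.Icc 0 t) :=
    ((hf.continuousOn_measureReal .univ).sub continuousOn_const).mono Set.Icc_subset_Ici_self
  obtain ⟨K, hK⟩ := isCompact_Icc.exists_bound_of_continuousOn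
    ((hf.continuousOn_measureReal .univ).mono (Set.Icc_subset_Ici_self : Set.Icc 0 t ⊆ Set.Ici 0))
  have h0 : m 0 - 1 = 0 := by
    have : m 0 = 1 := by
      rw [hm]
      simp only
      rw [hf.apply_zero .univ]
      simp
    linarith
  have hg := norm_le_gronwallBound_of_norm_deriv_right_le (K := |2 * lam| * K) (ε := 0) (δ := 0)
    hmc (fun s hs => (hder s hs.1).mono (Set.Ici_subset_Ici.2 hs.1)) (by simp [h0])
    (fun s hs => by
      rw [norm_mul, norm_mul, add_zero, Real.norm_eq_abs (2 * lam)]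
      gcongr
      exact hK s ⟨hs.1, hs.2.le⟩) t ⟨ht, le_rfl⟩
  have h1 : m t = 1 := by
    simp only [sub_zero, gronwallBound_ε0_δ0, norm_le_zero_iff] at hg
    linarith
  rw [← ofReal_measureReal]
  change ENNReal.ofReal (m t) = 1
  rw [h1, ENNReal.ofReal_one]

/-- Duhamel's formula for weak solutions, obtained by differentiating `e^{(2λ+μ)t} f_t(A)`. It is
stated as an identity in `[0, ∞]`, where all terms are monotone in the measures involved. -/
lemma IsWeakSolution.mild {lam mu : ℝ} (hlam : 0 ≤ lam) (hmu : 0 ≤ mu) {T : ℝ≥0}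
    {f₀ : FiniteMeasure ℝ} {f : ℝ → FiniteMeasure ℝ} (hf : IsWeakSolution lam mu T f₀ f)
    {A : Set ℝ} (hA : MeasurableSet A) {t : ℝ} (ht : 0 ≤ t) :
    (f t : Measure ℝ) A =
      ENNReal.ofReal (Real.exp (-((2 * lam + mu) * t))) * (f₀ : Measure ℝ) A +
      ∫⁻ s in Set.Icc 0 t, ENNReal.ofReal (Real.exp (-((2 * lam + mu) * (t - s)))) *
        (ENNReal.ofReal (2 * lam) * collisionMeasure (f s) (f s) A +
          ENNReal.ofReal mu * collisionMeasure (f s) (gaussianReal 0 T) A) := by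
  have hF := hf.continuousTV
  set a := 2 * lam + mu with ha
  set Q : ℝ → ℝ := fun s => 2 * lam * (B (f (max s 0)) (f (max s 0)) : Measure ℝ).real A +
    mu * (B (f (max s 0)) (gauss T).toFiniteMeasure : Measure ℝ).real A with hQ
  have hQc : Continuous Q := by
    have h1 := hF.continuous_B hF A
    have h2 := hF.continuous_B (continuousTV_const (gauss T).toFiniteMeasure) A
    fun_prop
  have hQ0 : ∀ s, 0 ≤ Q s := fun s => by positivity
  have hint : ∫ s in (0 : ℝ)..t, Real.exp (a * s) * Q s =
      Real.exp (a * t) * (f t : Measure ℝ).real A - (f₀ : Measure ℝ).real A := by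
    rw [intervalIntegral.integral_eq_sub_of_hasDeriv_right_of_le ht
      (f := fun s => Real.exp (a * s) * (f s : Measure ℝ).real A)]
    · simp [hf.apply_zero hA]
    · exact (Continuous.continuousOn (by fun_prop)).mul
        ((hf.continuousOn_measureReal hA).mono Set.Icc_subset_Ici_self)
    · intro s hs
      have h1 := (hf.hasDerivWithinAt hA hs.1.le).mono
        (Set.Ioi_subset_Ici_self.trans (Set.Ici_subset_Ici.2 hs.1.le))
      have h2 : HasDerivWithinAt (fun s : ℝ => Real.exp (a * s)) (Real.exp (a * s) * (a * 1))
        (Set.Ioi s) s := ((hasDerivWithinAt_id s _).const_mul a).exp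
      refine (h2.mul h1).congr_deriv ?_
      simp only [hQ, max_eq_left hs.1.le, ha]
      ring
    · exact Continuous.intervalIntegrable (by fun_prop) _ _
  have hreal : (f t : Measure ℝ).real A = Real.exp (-(a * t)) * (f₀ : Measure ℝ).real A +
      ∫ s in Set.Icc 0 t, Real.exp (-(a * (t - s))) * Q s := by
    have h1 : ∀ s, Real.exp (-(a * (t - s))) * Q s =
        Real.exp (-(a * t)) * (Real.exp (a * s) * Q s) := fun s => by
      rw [← mul_assoc, ← Real.exp_add]
      ring_nf
    simp_rw [h1]
    rw [integral_const_mul, integral_Icc_eq_integral_Ioc, ← intervalIntegral.integral_of_le ht,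
      hint, ← mul_add, add_sub_cancel, ← mul_assoc, ← Real.exp_add]
    simp
  have hQi : IntegrableOn (fun s => Real.exp (-(a * (t - s))) * Q s) (Set.Icc 0 t) :=
    Continuous.integrableOn_Icc (by fun_prop)
  rw [← ofReal_measureReal (μ := (f t : Measure ℝ)), hreal,
    ENNReal.ofReal_add (by positivity) (integral_nonneg fun s => mul_nonneg (by positivity) (hQ0 s)),
    ENNReal.ofReal_mul (by positivity), ofReal_measureReal,
    ofReal_integral_eq_lintegral_ofReal hQi
      (Eventually.of_forall fun s => mul_nonneg (by positivity) (hQ0 s))]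
  congr 1
  refine setLIntegral_congr_fun measurableSet_Icc fun s hs => ?_
  simp only [hQ, max_eq_left hs.1]
  rw [ENNReal.ofReal_mul (by positivity), ENNReal.ofReal_add (by positivity) (by positivity),
    ENNReal.ofReal_mul (by positivity), ENNReal.ofReal_mul hmu, ofReal_measureReal,
    ofReal_measureReal]
  rfl

/-- The Gaussian law is a stationary weak solution. -/
lemma isWeakSolution_gauss (lam mu : ℝ) (T : ℝ≥0) :
    IsWeakSolution lam mu T (gauss T).toFiniteMeasure fun _ => (gauss T).toFiniteMeasure where
  continuous_tv t _ := by simpa only [tvDist_self] using tendsto_const_nhds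
  equation t _ A _ := by
    have h : (B (gauss T).toFiniteMeasure (gauss T).toFiniteMeasure : Measure ℝ) =
        ((gauss T).toFiniteMeasure : Measure ℝ) := collisionMeasure_gaussianReal T
    simp [h]

/-! ### Monotone limits of measures -/

/-- An increasing sequence of finite measures starting at zero has a limit measure, namely the
sum of its increments. -/
lemma exists_lintegral_eq_iSup {α : Type*} [MeasurableSpace α] (ρ : ℕ → Measure α)
    [∀ n, IsFiniteMeasure (ρ n)] (h0 : ρ 0 = 0) (hρ : ∀ n, ρ n ≤ ρ (n + 1)) :
    ∃ ρ' : Measure α, ∀ h : α → ℝ≥0∞, ∫⁻ x, h x ∂ρ' = ⨆ n, ∫⁻ x, h x ∂ρ n := by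
  have hsum : ∀ n, ∑ k ∈ Finset.range n, (ρ (k + 1) - ρ k) = ρ n := by
    intro n
    induction n with
    | zero => simp [h0]
    | succ n ih => rw [Finset.sum_range_succ, ih, add_comm, Measure.sub_add_cancel_of_le (hρ n)]
  refine ⟨Measure.sum fun n => ρ (n + 1) - ρ n, fun h => ?_⟩
  rw [lintegral_sum_measure, ENNReal.tsum_eq_iSup_nat]
  refine iSup_congr fun n => ?_
  rw [← lintegral_finsetSum_measure, hsum]

/-! ### Coupled Picard iterates -/

/-- Duhamel's kernel `t ↦ c e^{-a (t - s)} 1_{0 ≤ s ≤ t} ds`. The density takes values in `ℝ≥0`,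
which makes the kernel s-finite; it is meant for `c ≥ 0`. -/
def duhamelKernel (a c : ℝ) : Kernel ℝ ℝ :=
  Kernel.withDensity (Kernel.const ℝ volume) fun t s =>
    ((Set.Icc 0 t).indicator (fun s => (c * Real.exp (-(a * (t - s)))).toNNReal) s : ℝ≥0)

lemma measurable_duhamel_density (a c : ℝ) : Measurable fun p : ℝ × ℝ =>
    (Set.Icc 0 p.1).indicator (fun s => (c * Real.exp (-(a * (p.1 - s)))).toNNReal) p.2 := by
  have : (fun p : ℝ × ℝ =>
      (Set.Icc 0 p.1).indicator (fun s => (c * Real.exp (-(a * (p.1 - s)))).toNNReal) p.2) =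
      ({p : ℝ × ℝ | 0 ≤ p.2} ∩ {p | p.2 ≤ p.1}).indicator
        fun p => (c * Real.exp (-(a * (p.1 - p.2)))).toNNReal := by
    ext p
    simp [Set.indicator_apply]
  rw [this]
  exact Measurable.indicator (by fun_prop)
    ((measurableSet_le measurable_const measurable_snd).inter
      (measurableSet_le measurable_snd measurable_fst))

instance (a c : ℝ) : IsSFiniteKernel (duhamelKernel a c) := by
  unfold duhamelKernel
  infer_instance

lemma lintegral_duhamelKernel {a c : ℝ} (hc : 0 ≤ c) (t : ℝ) {h : ℝ → ℝ≥0∞} (hh : Measurable h) :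
    ∫⁻ s, h s ∂duhamelKernel a c t =
      ∫⁻ s in Set.Icc 0 t, ENNReal.ofReal (Real.exp (-(a * (t - s)))) *
        (ENNReal.ofReal c * h s) := by
  rw [duhamelKernel, Kernel.lintegral_withDensity _
    (measurable_duhamel_density a c).coe_nnreal_ennreal _ hh, Kernel.const_apply,
    ← lintegral_indicator measurableSet_Icc]
  refine lintegral_congr fun s => ?_
  by_cases hs : s ∈ Set.Icc 0 t
  · simp only [Set.indicator_of_mem hs]
    change ENNReal.ofReal _ * _ = _
    rw [ENNReal.ofReal_mul hc, mul_comm (ENNReal.ofReal c), mul_assoc]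
  · simp [Set.indicator_of_notMem hs]

/-- `pairCollision` for kernels. -/
def collisionKernel (κ η : Kernel ℝ (ℝ × ℝ)) : Kernel ℝ (ℝ × ℝ) :=
  (κ ×ₖ (η ×ₖ Kernel.const ℝ unifAngle)).map collisionMap

instance (κ η : Kernel ℝ (ℝ × ℝ)) [IsSFiniteKernel κ] [IsSFiniteKernel η] :
    IsSFiniteKernel (collisionKernel κ η) := by
  unfold collisionKernel
  infer_instance

lemma collisionKernel_apply (κ η : Kernel ℝ (ℝ × ℝ)) [IsSFiniteKernel κ] [IsSFiniteKernel η]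
    (s : ℝ) : collisionKernel κ η s = pairCollision (κ s) (η s) := by
  rw [collisionKernel, Kernel.map_apply _ measurable_collisionMap, Kernel.prod_apply,
    Kernel.prod_apply, Kernel.const_apply, pairCollision]

/-- The trivial coupling of the Gaussian law with itself. -/
def diagGauss (T : ℝ≥0) : Measure (ℝ × ℝ) :=
  (gaussianReal 0 T).map fun y => (y, y)

instance (T : ℝ≥0) : IsProbabilityMeasure (diagGauss T) :=
  Measure.isProbabilityMeasure_map (by fun_prop)

lemma cost_diagGauss (T : ℝ≥0) : cost (diagGauss T) = 0 := by
  rw [cost, diagGauss, lintegral_map measurable_sq_sub (by fun_prop)]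
  simp

lemma map_diagGauss (T : ℝ≥0) (L : ℝ × ℝ →L[ℝ] ℝ) (hL : ∀ y, L (y, y) = y) :
    (diagGauss T).map L = gaussianReal 0 T := by
  rw [diagGauss, Measure.map_map L.continuous.measurable (by fun_prop),
    show L ∘ (fun y => (y, y)) = id from funext hL, Measure.map_id]

/-- The Picard iterates, started from zero, of the mild form of the coupled equation
`∂ₜπ = 2λ (B[π, π] - π) + μ (B[π, Γ] - π)` on `ℝ × ℝ`, where `Γ` is the diagonal Gaussian coupling.
Each iterate is a kernel in the time variable, which provides the measurability in `s` of the
integrand; only its values at times `t ≥ 0` matter. -/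
def picard (lam mu : ℝ) (T : ℝ≥0) (π₀ : Measure (ℝ × ℝ)) [SFinite π₀] :
    ℕ → Kernel ℝ (ℝ × ℝ)
  | 0 => 0
  | n + 1 =>
    Kernel.withDensity (Kernel.const ℝ π₀)
        (fun t _ => ((Real.exp (-((2 * lam + mu) * t))).toNNReal : ℝ≥0)) +
      (collisionKernel (picard lam mu T π₀ n) (picard lam mu T π₀ n) ∘ₖ
          duhamelKernel (2 * lam + mu) (2 * lam) +
        collisionKernel (picard lam mu T π₀ n) (Kernel.const ℝ (diagGauss T)) ∘ₖ
          duhamelKernel (2 * lam + mu) mu)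

section

variable {lam mu : ℝ} {T : ℝ≥0} {π₀ : Measure (ℝ × ℝ)}

instance [SFinite π₀] (n : ℕ) : IsSFiniteKernel (picard lam mu T π₀ n) := by
  induction n with
  | zero => unfold picard; infer_instance
  | succ n ih => unfold picard; infer_instance

lemma lintegral_picard_succ [SFinite π₀] (hlam : 0 ≤ lam) (hmu : 0 ≤ mu) (n : ℕ) (t : ℝ)
    {h : ℝ × ℝ → ℝ≥0∞} (hh : Measurable h) :
    ∫⁻ p, h p ∂picard lam mu T π₀ (n + 1) t =
      ENNReal.ofReal (Real.exp (-((2 * lam + mu) * t))) * ∫⁻ p, h p ∂π₀ +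
      ∫⁻ s in Set.Icc 0 t, ENNReal.ofReal (Real.exp (-((2 * lam + mu) * (t - s)))) *
        (ENNReal.ofReal (2 * lam) * ∫⁻ p, h p
            ∂pairCollision (picard lam mu T π₀ n s) (picard lam mu T π₀ n s) +
          ENNReal.ofReal mu * ∫⁻ p, h p
            ∂pairCollision (picard lam mu T π₀ n s) (diagGauss T)) := by
  have hm := hh.lintegral_kernel (κ := collisionKernel (picard lam mu T π₀ n)
    (picard lam mu T π₀ n))
  have hm' := hh.lintegral_kernel (κ := collisionKernel (picard lam mu T π₀ n)
    (Kernel.const ℝ (diagGauss T)))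
  rw [picard, add_apply, add_apply, lintegral_add_measure, lintegral_add_measure,
    Kernel.lintegral_comp _ _ _ hh, Kernel.lintegral_comp _ _ _ hh,
    lintegral_duhamelKernel (by positivity) _ hm, lintegral_duhamelKernel hmu _ hm',
    ← lintegral_add_left (by fun_prop)]
  congr 1
  · rw [Kernel.lintegral_withDensity _ (by fun_prop) _ hh, Kernel.const_apply,
      lintegral_const_mul _ hh]
    rfl
  · simp only [collisionKernel_apply, Kernel.const_apply, mul_add]

lemma picard_succ_apply [SFinite π₀] (hlam : 0 ≤ lam) (hmu : 0 ≤ mu) (n : ℕ) (t : ℝ)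
    {A : Set (ℝ × ℝ)} (hA : MeasurableSet A) :
    picard lam mu T π₀ (n + 1) t A =
      ENNReal.ofReal (Real.exp (-((2 * lam + mu) * t))) * π₀ A +
      ∫⁻ s in Set.Icc 0 t, ENNReal.ofReal (Real.exp (-((2 * lam + mu) * (t - s)))) *
        (ENNReal.ofReal (2 * lam) *
            pairCollision (picard lam mu T π₀ n s) (picard lam mu T π₀ n s) A +
          ENNReal.ofReal mu * pairCollision (picard lam mu T π₀ n s) (diagGauss T) A) := by
  have := lintegral_picard_succ (T := T) (π₀ := π₀) hlam hmu n t (measurable_one.indicator hA)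
  simpa only [lintegral_indicator_one hA] using this

lemma picard_le_succ [SFinite π₀] (hlam : 0 ≤ lam) (hmu : 0 ≤ mu) (n : ℕ) (t : ℝ) :
    picard lam mu T π₀ n t ≤ picard lam mu T π₀ (n + 1) t := by
  induction n generalizing t with
  | zero => exact Measure.zero_le _
  | succ n ih =>
    refine Measure.le_iff.2 fun A hA => ?_
    rw [picard_succ_apply hlam hmu _ _ hA, picard_succ_apply hlam hmu _ _ hA]
    gcongr with s
    · exact pairCollision_mono (ih s) (ih s)
    · exact pairCollision_mono (ih s) le_rfl

/-! ### Bounds on the iterates -/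

lemma lintegral_exp_mul_exp {a b t : ℝ} (hab : b ≤ a) (ht : 0 ≤ t) :
    ∫⁻ s in Set.Icc 0 t, ENNReal.ofReal (Real.exp (-(a * (t - s)))) *
        ENNReal.ofReal ((a - b) * Real.exp (-(b * s))) =
      ENNReal.ofReal (Real.exp (-(b * t)) - Real.exp (-(a * t))) := by
  have hc : Continuous fun s => Real.exp (-(a * (t - s))) * ((a - b) * Real.exp (-(b * s))) := by
    fun_prop
  have hint : ∫ s in (0 : ℝ)..t, Real.exp (-(a * (t - s))) * ((a - b) * Real.exp (-(b * s))) =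
      Real.exp (-(b * t)) - Real.exp (-(a * t)) := by
    rw [intervalIntegral.integral_eq_sub_of_hasDerivAt
      (f := fun s => Real.exp (-(a * (t - s)) + -(b * s)))]
    · simp
    · intro s _
      have h1 : HasDerivAt (fun s : ℝ => -(a * (t - s)) + -(b * s)) (a - b) s := by
        have := ((((hasDerivAt_id s).const_sub t).const_mul a).neg).add
          (((hasDerivAt_id s).const_mul b).neg)
        refine this.congr_deriv ?_
        ring
      refine h1.exp.congr_deriv ?_
      rw [Real.exp_add]
      ring
    · exact hc.intervalIntegrable _ _
  simp_rw [← ENNReal.ofReal_mul (Real.exp_nonneg _)]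
  rw [← ofReal_integral_eq_lintegral_ofReal hc.integrableOn_Icc, integral_Icc_eq_integral_Ioc,
    ← intervalIntegral.integral_of_le ht, hint]
  exact Eventually.of_forall fun s =>
    mul_nonneg (Real.exp_nonneg _) (mul_nonneg (sub_nonneg.2 hab) (Real.exp_nonneg _))

/-- The computation behind all bounds on the iterates: `e^{-bt}` solves Duhamel's equation with
decay rate `a` and source `(a - b) e^{-bs}`. -/
lemma ofReal_exp_add_lintegral {a b t : ℝ} (hab : b ≤ a) (ht : 0 ≤ t) :
    ENNReal.ofReal (Real.exp (-(a * t))) +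
      ∫⁻ s in Set.Icc 0 t, ENNReal.ofReal (Real.exp (-(a * (t - s)))) *
        ENNReal.ofReal ((a - b) * Real.exp (-(b * s))) =
      ENNReal.ofReal (Real.exp (-(b * t))) := by
  have : Real.exp (-(a * t)) ≤ Real.exp (-(b * t)) :=
    Real.exp_le_exp.2 (neg_le_neg (mul_le_mul_of_nonneg_right hab ht))
  rw [lintegral_exp_mul_exp hab ht, ← ENNReal.ofReal_add (Real.exp_nonneg _) (sub_nonneg.2 this),
    add_sub_cancel]

lemma picard_univ_le_one [IsProbabilityMeasure π₀] (hlam : 0 ≤ lam) (hmu : 0 ≤ mu) (n : ℕ)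
    {t : ℝ} (ht : 0 ≤ t) : picard lam mu T π₀ n t Set.univ ≤ 1 := by
  induction n generalizing t with
  | zero => simp [picard]
  | succ n ih =>
    have h := ofReal_exp_add_lintegral (a := 2 * lam + mu) (b := 0) (by positivity) ht
    simp only [zero_mul, neg_zero, Real.exp_zero, ENNReal.ofReal_one, sub_zero, mul_one] at h
    rw [picard_succ_apply hlam hmu _ _ .univ, measure_univ, mul_one, ← h]
    refine add_le_add le_rfl (setLIntegral_mono' measurableSet_Icc fun s hs => ?_)
    rw [pairCollision_univ, pairCollision_univ, measure_univ (μ := diagGauss T),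
      ENNReal.ofReal_add (by positivity) hmu]
    have := ih hs.1
    gcongr
    · exact mul_le_of_le_one_right' (mul_le_one' this this)
    · exact mul_le_of_le_one_right' (mul_le_one' this le_rfl)

/-- The factor `1 / 2` in the average over the angle, applied to the thermostat term, whose
partner `Γ` has cost zero, produces the rate `μ / 2`. -/
lemma cost_picard_le [IsProbabilityMeasure π₀] (hlam : 0 ≤ lam) (hmu : 0 ≤ mu) (n : ℕ)
    {t : ℝ} (ht : 0 ≤ t) :
    cost (picard lam mu T π₀ n t) ≤ ENNReal.ofReal (Real.exp (-(mu / 2 * t))) * cost π₀ := by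
  induction n generalizing t with
  | zero => simp [picard, cost]
  | succ n ih =>
    have h := ofReal_exp_add_lintegral (a := 2 * lam + mu) (b := mu / 2) (by linarith) ht
    rw [cost, lintegral_picard_succ hlam hmu _ _ measurable_sq_sub, ← h, add_mul (ENNReal.ofReal _),
      ← lintegral_mul_const _ (by fun_prop)]
    refine add_le_add le_rfl (setLIntegral_mono' measurableSet_Icc fun s hs => ?_)
    change _ * (_ * cost (pairCollision _ _) + _ * cost (pairCollision _ _)) ≤ _
    have h1 := picard_univ_le_one (T := T) (π₀ := π₀) hlam hmu n hs.1
    have h2 := ih hs.1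
    rw [cost_pairCollision, cost_pairCollision, cost_diagGauss, measure_univ (μ := diagGauss T),
      mul_zero, add_zero, mul_one, mul_assoc]
    set c := cost (picard lam mu T π₀ n s)
    refine mul_le_mul' le_rfl ?_
    have h3 : (c * picard lam mu T π₀ n s Set.univ + picard lam mu T π₀ n s Set.univ * c) / 2 ≤ c :=
      calc _ ≤ (c * 1 + 1 * c) / 2 := by gcongr
        _ = c := by rw [mul_one, one_mul, ENNReal.add_div, ENNReal.add_halves]
    calc _ ≤ ENNReal.ofReal (2 * lam) * c + ENNReal.ofReal mu * (c / 2) := by gcongr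
      _ = ENNReal.ofReal (2 * lam + mu - mu / 2) * c := by
        rw [show 2 * lam + mu - mu / 2 = 2 * lam + mu / 2 by ring,
          ENNReal.ofReal_add (by positivity) (by positivity), ENNReal.ofReal_div_of_pos two_pos,
          add_mul, div_eq_mul_inv, div_eq_mul_inv, ENNReal.ofReal_ofNat]
        ring
      _ ≤ ENNReal.ofReal (2 * lam + mu - mu / 2) *
          (ENNReal.ofReal (Real.exp (-(mu / 2 * s))) * cost π₀) := by gcongr
      _ = _ := by rw [ENNReal.ofReal_mul (by linarith), mul_assoc]

/-- A lower bound that forces the mass of the iterates to converge to one. The mass missing from the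
`n`-th iterate is at most `2⁻ⁿ e^{2Kt}` with `K = 4λ + μ`: the iteration is a contraction for the
norm weighted by `e^{-2Kt}`. -/
lemma one_le_picard_univ_add [IsProbabilityMeasure π₀] (hlam : 0 ≤ lam) (hmu : 0 ≤ mu) (n : ℕ)
    {t : ℝ} (ht : 0 ≤ t) :
    1 ≤ picard lam mu T π₀ n t Set.univ +
      2⁻¹ ^ n * ENNReal.ofReal (Real.exp (2 * (4 * lam + mu) * t)) := by
  induction n generalizing t with
  | zero =>
    simp only [pow_zero, one_mul]
    refine le_add_left ?_
    rw [ENNReal.one_le_ofReal]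
    exact Real.one_le_exp (by positivity)
  | succ n ih =>
    set K := 4 * lam + mu with hK
    have hK0 : 0 ≤ K := by positivity
    have h := ofReal_exp_add_lintegral (a := 2 * lam + mu) (b := 0) (by positivity) ht
    simp only [zero_mul, neg_zero, Real.exp_zero, ENNReal.ofReal_one, sub_zero, mul_one] at h
    have h' : ∫⁻ s in Set.Icc 0 t, ENNReal.ofReal (Real.exp (-((2 * lam + mu) * (t - s)))) *
        (ENNReal.ofReal K * (2⁻¹ ^ n * ENNReal.ofReal (Real.exp (2 * K * s)))) ≤
        2⁻¹ ^ (n + 1) * ENNReal.ofReal (Real.exp (2 * K * t)) := by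
      have h1 := (lintegral_exp_mul_exp (a := 2 * lam + mu) (b := -(2 * K))
        (by linarith) ht).trans_le (ENNReal.ofReal_le_ofReal (sub_le_self _ (Real.exp_nonneg _)))
      simp only [neg_mul, neg_neg] at h1
      calc _ ≤ ∫⁻ s in Set.Icc 0 t, 2⁻¹ ^ (n + 1) *
            (ENNReal.ofReal (Real.exp (-((2 * lam + mu) * (t - s)))) *
            ENNReal.ofReal ((2 * lam + mu - -(2 * K)) * Real.exp (2 * K * s))) := by
            refine lintegral_mono fun s => ?_
            have h2 : ENNReal.ofReal K ≤ 2⁻¹ * ENNReal.ofReal (2 * lam + mu - -(2 * K)) := by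
              calc ENNReal.ofReal K = 2⁻¹ * ENNReal.ofReal (2 * K) := by
                    rw [ENNReal.ofReal_mul two_pos.le, ← mul_assoc, ENNReal.ofReal_ofNat,
                      ENNReal.inv_mul_cancel two_ne_zero ENNReal.ofNat_ne_top, one_mul]
                _ ≤ _ := by
                    gcongr
                    linarith
            rw [ENNReal.ofReal_mul (by linarith)]
            calc _ ≤ ENNReal.ofReal (Real.exp (-((2 * lam + mu) * (t - s)))) *
                  (2⁻¹ * ENNReal.ofReal (2 * lam + mu - -(2 * K)) *
                    (2⁻¹ ^ n * ENNReal.ofReal (Real.exp (2 * K * s)))) := by gcongr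
              _ = _ := by ring
        _ ≤ _ := by
            rw [lintegral_const_mul _ (by fun_prop)]
            gcongr
    rw [picard_succ_apply hlam hmu _ _ .univ, measure_univ, mul_one]
    refine h.symm.trans_le ?_
    rw [add_assoc]
    refine add_le_add le_rfl (le_trans ?_ (add_le_add le_rfl h'))
    rw [← lintegral_add_right _ (by fun_prop)]
    refine setLIntegral_mono' measurableSet_Icc fun s hs => ?_
    rw [← mul_add]
    refine mul_le_mul' le_rfl ?_
    rw [pairCollision_univ, pairCollision_univ, measure_univ (μ := diagGauss T), mul_one]
    have hm := picard_univ_le_one (T := T) (π₀ := π₀) hlam hmu n hs.1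
    have hd := ih hs.1
    set m := picard lam mu T π₀ n s Set.univ
    set d := 2⁻¹ ^ n * ENNReal.ofReal (Real.exp (2 * K * s))
    -- From `1 ≤ m + d` and `m ≤ 1` the quadratic term loses at most `2 d`.
    have hsq : 1 ≤ m * m + 2 * d := by
      calc 1 ≤ m + d := hd
        _ ≤ m * (m + d) + d := by gcongr; exact le_mul_of_one_le_right' hd
        _ ≤ m * m + 2 * d := by
          rw [mul_add, add_assoc, two_mul]
          gcongr
          exact mul_le_of_le_one_left' hm
    calc ENNReal.ofReal (2 * lam + mu) = ENNReal.ofReal (2 * lam) * 1 + ENNReal.ofReal mu * 1 := by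
          rw [ENNReal.ofReal_add (by positivity) hmu, mul_one, mul_one]
      _ ≤ ENNReal.ofReal (2 * lam) * (m * m + 2 * d) + ENNReal.ofReal mu * (m + d) := by gcongr
      _ = _ := by
        rw [hK, ENNReal.ofReal_add (by positivity) hmu, show 4 * lam = 2 * lam * 2 by ring,
          ENNReal.ofReal_mul (p := 2 * lam) (by positivity), ENNReal.ofReal_ofNat]
        ring

/-- The marginals of the iterates stay below any weak solution with the right initial condition. -/
lemma map_picard_le [SFinite π₀] (hlam : 0 ≤ lam) (hmu : 0 ≤ mu) {f₀ : FiniteMeasure ℝ}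
    {f : ℝ → FiniteMeasure ℝ} (hf : IsWeakSolution lam mu T f₀ f) {L : ℝ × ℝ →L[ℝ] ℝ}
    (hL : ∀ y, L (y, y) = y) (h₀ : π₀.map L = f₀) (n : ℕ) {t : ℝ} (ht : 0 ≤ t) :
    (picard lam mu T π₀ n t).map L ≤ f t := by
  have hLm : Measurable L := L.continuous.measurable
  induction n generalizing t with
  | zero => simp [picard, Measure.zero_le]
  | succ n ih =>
    refine Measure.le_iff.2 fun A hA => ?_
    rw [Measure.map_apply hLm hA, picard_succ_apply hlam hmu _ _ (hLm hA),
      hf.mild hlam hmu hA ht, ← h₀, Measure.map_apply hLm hA]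
    refine add_le_add le_rfl (setLIntegral_mono' measurableSet_Icc fun s hs => ?_)
    rw [← Measure.map_apply hLm hA, ← Measure.map_apply hLm hA, map_pairCollision,
      map_pairCollision, map_diagGauss T L hL]
    gcongr
    · exact collisionMeasure_mono (ih hs.1) (ih hs.1)
    · exact collisionMeasure_mono (ih hs.1) le_rfl

/-- An initial coupling propagates to a coupling of two weak solutions, with exponentially
decreasing cost. -/
lemma exists_coupling (hlam : 0 ≤ lam) (hmu : 0 ≤ mu) {f₀ g₀ : ProbabilityMeasure ℝ}
    {f g : ℝ → FiniteMeasure ℝ} (hf : IsWeakSolution lam mu T f₀.toFiniteMeasure f)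
    (hg : IsWeakSolution lam mu T g₀.toFiniteMeasure g)
    (h₁ : π₀.map Prod.fst = f₀) (h₂ : π₀.map Prod.snd = g₀) {t : ℝ} (ht : 0 ≤ t) :
    ∃ π : Measure (ℝ × ℝ), (π.map Prod.fst = f t ∧ π.map Prod.snd = g t) ∧
      cost π ≤ ENNReal.ofReal (Real.exp (-(mu / 2 * t))) * cost π₀ := by
  have : IsProbabilityMeasure π₀ := ⟨by
    rw [← Set.preimage_univ (f := Prod.fst), ← Measure.map_apply measurable_fst .univ, h₁,
      measure_univ]⟩
  have : ∀ n, IsFiniteMeasure (picard lam mu T π₀ n t) := fun n =>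
    ⟨(picard_univ_le_one hlam hmu n ht).trans_lt ENNReal.one_lt_top⟩
  obtain ⟨π, hπ⟩ := exists_lintegral_eq_iSup (fun n => picard lam mu T π₀ n t) (by simp [picard])
    fun n => picard_le_succ hlam hmu n t
  have hA : ∀ A, MeasurableSet A → π A = ⨆ n, picard lam mu T π₀ n t A := fun A hA => by
    simpa only [lintegral_indicator_one hA] using hπ (A.indicator 1)
  have huniv : π Set.univ = 1 := by
    refine le_antisymm ?_ ?_
    · rw [hA _ .univ]
      exact iSup_le fun n => picard_univ_le_one (π₀ := π₀) hlam hmu n ht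
    · have hlim : Tendsto (fun n : ℕ => π Set.univ +
          2⁻¹ ^ n * ENNReal.ofReal (Real.exp (2 * (4 * lam + mu) * t))) atTop
          (𝓝 (π Set.univ + 0 * ENNReal.ofReal (Real.exp (2 * (4 * lam + mu) * t)))) :=
        tendsto_const_nhds.add (ENNReal.Tendsto.mul_const
          (ENNReal.tendsto_pow_atTop_nhds_zero_of_lt_one (by simp))
          (Or.inr ENNReal.ofReal_ne_top))
      rw [zero_mul, add_zero] at hlim
      refine ge_of_tendsto' hlim fun n =>
        (one_le_picard_univ_add (T := T) (π₀ := π₀) hlam hmu n ht).trans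
          (add_le_add ?_ le_rfl)
      rw [hA _ .univ]
      exact le_iSup (fun n => picard lam mu T π₀ n t Set.univ) n
  have hmarg : ∀ (f₀ : ProbabilityMeasure ℝ) (f : ℝ → FiniteMeasure ℝ),
      IsWeakSolution lam mu T f₀.toFiniteMeasure f → ∀ L : ℝ × ℝ →L[ℝ] ℝ,
      (∀ y, L (y, y) = y) → π₀.map L = f₀ → π.map L = f t := by
    intro f₀ f hf L hL h₀
    have hLm : Measurable L := L.continuous.measurable
    have : IsFiniteMeasure (π.map L) := ⟨by
      rw [Measure.map_apply hLm .univ, Set.preimage_univ, huniv]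
      exact ENNReal.one_lt_top⟩
    refine Measure.eq_of_le_of_measure_univ_eq (Measure.le_iff.2 fun A hAm => ?_) ?_
    · rw [Measure.map_apply hLm hAm, hA _ (hLm hAm)]
      refine iSup_le fun n => ?_
      rw [← Measure.map_apply hLm hAm]
      exact map_picard_le hlam hmu hf hL h₀ n ht A
    · rw [Measure.map_apply hLm .univ, Set.preimage_univ, huniv, hf.measure_univ ht]
  refine ⟨π, ⟨hmarg f₀ f hf (.fst ℝ ℝ ℝ) (fun _ => rfl) h₁,
    hmarg g₀ g hg (.snd ℝ ℝ ℝ) (fun _ => rfl) h₂⟩, ?_⟩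
  rw [cost, hπ]
  exact iSup_le fun n => cost_picard_le hlam hmu n ht

end

/-! ### Contraction of the Wasserstein distance -/

lemma W2_sq (ν₁ ν₂ : Measure ℝ) :
    W2 ν₁ ν₂ ^ 2 = ⨅ (π : Measure (ℝ × ℝ)) (_ : π.map Prod.fst = ν₁ ∧ π.map Prod.snd = ν₂),
      cost π := by
  rw [W2, ← ENNReal.rpow_natCast, ← ENNReal.rpow_mul]
  norm_num
  rfl

lemma W2_sq_le {lam mu : ℝ} (hlam : 0 ≤ lam) (hmu : 0 ≤ mu) {T : ℝ≥0}
    {f₀ g₀ : ProbabilityMeasure ℝ} {f g : ℝ → FiniteMeasure ℝ}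
    (hf : IsWeakSolution lam mu T f₀.toFiniteMeasure f)
    (hg : IsWeakSolution lam mu T g₀.toFiniteMeasure g) {t : ℝ} (ht : 0 ≤ t) :
    W2 (f t : Measure ℝ) (g t : Measure ℝ) ^ 2 ≤
      ENNReal.ofReal (Real.exp (-(mu / 2) * t)) *
        W2 (f₀ : Measure ℝ) (g₀ : Measure ℝ) ^ 2 := by
  have hpos : ENNReal.ofReal (Real.exp (-(mu / 2) * t)) ≠ 0 := by
    simpa using Real.exp_pos _
  rw [W2_sq, W2_sq, ENNReal.mul_iInf_of_ne hpos ENNReal.ofReal_ne_top]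
  refine le_iInf fun π₀ => ?_
  rw [ENNReal.mul_iInf_of_ne hpos ENNReal.ofReal_ne_top]
  refine le_iInf fun hπ₀ => ?_
  obtain ⟨π, hπ, hc⟩ := exists_coupling hlam hmu hf hg hπ₀.1 hπ₀.2 ht
  rw [neg_mul]
  exact (iInf₂_le π hπ).trans hc

end

end ThermostatedKac

theorem lemma3 (lam mu : ℝ) (hlam : 0 < lam) (hmu : 0 < mu) (T : ℝ≥0) (hT : 0 < T) :
    (∀ (f₀ g₀ : ProbabilityMeasure ℝ) (f g : ℝ → FiniteMeasure ℝ),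
      ThermostatedKac.IsWeakSolution lam mu T f₀.toFiniteMeasure f →
      ThermostatedKac.IsWeakSolution lam mu T g₀.toFiniteMeasure g →
      ∀ t : ℝ, 0 ≤ t →
        ThermostatedKac.W2 (f t : Measure ℝ) (g t : Measure ℝ) ^ 2 ≤
          ENNReal.ofReal (Real.exp (-(mu / 2) * t)) *
            ThermostatedKac.W2 (f₀ : Measure ℝ) (g₀ : Measure ℝ) ^ 2) ∧
    (∀ (f₀ : ProbabilityMeasure ℝ) (f : ℝ → FiniteMeasure ℝ),
      ThermostatedKac.IsWeakSolution lam mu T f₀.toFiniteMeasure f →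
      ∀ t : ℝ, 0 ≤ t →
        ThermostatedKac.W2 (f t : Measure ℝ) (ThermostatedKac.gauss T : Measure ℝ) ^ 2 ≤
          ENNReal.ofReal (Real.exp (-(mu / 2) * t)) *
            ThermostatedKac.W2 (f₀ : Measure ℝ) (ThermostatedKac.gauss T : Measure ℝ) ^ 2) :=
  ⟨fun _ _ _ _ hf hg _ ht => ThermostatedKac.W2_sq_le hlam.le hmu.le hf hg ht,
    fun _ _ hf _ ht => ThermostatedKac.W2_sq_le hlam.le hmu.le hf
      (ThermostatedKac.isWeakSolution_gauss lam mu T) ht⟩
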